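/- Let $k$ be a positive integer, let $\beta>0$ be a real number, and let $\mathbb F$ be a finite field. There exists an integer $c$, depending only on $k$, $\beta$ and $\mathbb F$, such that the following holds. If $M$ is an $\mathbb F$-represented matroid of rank $r>2$ with $|M|\ge(1+\beta)r$, and there is an $\mathbb F$-represented frame matroid $N$ with connected graph, on the same ground set as $M$, with $\operatorname{dist}(M,N)\le k$, then $M$ has a circuit and its girth satisfies $g(M)\le c\log r$, where $\log$ is the natural logarithm. The terms are as follows. An $\mathbb F$-represented matroid is a pair $M=(E,U)$ with $E$ a finite set and $U$ a subspace of $\mathbb F^E$. Write $|M|=|E|$, let $r_M(X)=\dim(U|X)$ for $X\subseteq E$, where $U|X$ is the restriction of $U$ to the coordinates in $X$, and let the rank of $M$ be $r(M)=r_M(E)$. A set $X$ is dependent if $r_M(X)\ne|X|$, a circuit is a minimal dependent set, and the girth $g(M)$ is the size of a smallest circuit. The dual is $M^*=(E,U^\perp)$, where $U^\perp$ is the orthogonal complement for the standard bilinear form; for $e\in E$, $M\setminus e=(E-\{e\},\,U|(E-\{e\}))$ and $M/e=(M^*\setminus e)^*$. For $\mathbb F$-represented matroids $M_1,M_2$ on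 a common ground set $E$, if some $\mathbb F$-represented matroid $P$ on $E\cup\{e\}$, with $e\notin E$, satisfies $P\setminus e=M_1$ and $P/e=M_2$, then $M_2$ is an elementary projection of $M_1$ and $M_1$ is an elementary lift of $M_2$. The distance $\operatorname{dist}(M,N)$ is the minimum number of elementary lifts and projections needed to transform $M$ into $N$. A frame matrix is an $\mathbb F$-matrix $A$, with finite row set $V$ and column set $E$, in which every column has at most two nonzero entries. A graph representation of $A$ is a directed graph $G$ with vertex set $V$ and arc set $E$ (loops and multiple arcs allowed), together with a label in $\mathbb F^\times$ for each arc, such that for each $e\in E$: if the nonzero entries of column $e$ are in exactly the two rows $x\neq y$, then $e$ is an arc from $x$ to $y$ with label $-A_{x,e}A_{y,e}^{-1}$ or an arc from $y$ to $x$ with label $-A_{y,e}A_{x,e}^{-1}$; if column $e$ has exactly one nonzero entry, in row $x$, then $e$ is a loop at $x$ with label different from $1$; and if column $e$ is zero, then $e$ is a loop with label $1$. An $\mathbb F$-represented frame matroid with connected graph is an $\mathbb F$-represented matroid $N=(E,U)$ such that $U$ is the row space of a frame matrix that has a graph representation whose graph $G$ is connected, that is, every two vertices are joined by a path of the underlying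 undirected graph. -/

import Mathlib

universe u v w

/-- An `F`-represented matroid with ground set `E`: a subspace of `F ^ E`. -/
@[ext]
structure RepMatroid (F : Type u) [Field F] (E : Type v) where
  /-- The underlying subspace of `F ^ E`. -/
  space : Submodule F (E → F)

namespace RepMatroid

/-- The restriction `U | X` of the space of `M` to the coordinates in `X`. -/
def restrictSpace {F : Type u} [Field F] {E : Type v} (M : RepMatroid F E) (X : Finset E) :
    Submodule F (X → F) :=
  M.space.map (LinearMap.funLeft F F (fun x : X => (x : E)))

/-- The rank function `r_M(X) = dim (U | X)`. -/
noncomputable def rk {F : Type u} [Field F] {E : Type v} (M : RepMatroid F E)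
    (X : Finset E) : ℕ :=
  Module.finrank F (M.restrictSpace X)

/-- The rank `r(M) = r_M(E)`. -/
noncomputable def rank {F : Type u} [Field F] {E : Type v} [Fintype E]
    (M : RepMatroid F E) : ℕ :=
  M.rk Finset.univ

/-- `X` is dependent in `M` if it is not the case that `r_M(X) = |X|`. -/
def Dependent {F : Type u} [Field F] {E : Type v} (M : RepMatroid F E) (X : Finset E) : Prop :=
  M.rk X ≠ X.card

/-- A circuit is an inclusion-minimal dependent set. -/
def IsCircuit {F : Type u} [Field F] {E : Type v} (M : RepMatroid F E) (C : Finset E) : Prop :=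
  Minimal M.Dependent C

/-- The girth: the size of a smallest circuit, and `⊤` if there is no circuit. -/
noncomputable def girth {F : Type u} [Field F] {E : Type v} (M : RepMatroid F E) : ℕ∞ :=
  ⨅ (C : Finset E) (_ : M.IsCircuit C), (C.card : ℕ∞)

/-- The dual matroid: the orthogonal complement with respect to the standard bilinear form. -/
def dual {F : Type u} [Field F] {E : Type v} [Fintype E] (M : RepMatroid F E) :
    RepMatroid F E where
  space :=
    { carrier := {x | ∀ y ∈ M.space, x ⬝ᵥ y = 0}
      zero_mem' := fun y _ => zero_dotProduct y
      add_mem' := fun {a b} ha hb y hy => by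
        rw [add_dotProduct, ha y hy, hb y hy, add_zero]
      smul_mem' := fun c a ha y hy => by
        rw [smul_dotProduct, ha y hy, smul_zero] }

/-- Deletion of the elements outside the range of `f`; the remaining elements are named by `f`. -/
def deleteTo {F : Type u} [Field F] {E : Type v} {E₀ : Type w} (M : RepMatroid F E)
    (f : E₀ ↪ E) : RepMatroid F E₀ where
  space := M.space.map (LinearMap.funLeft F F f)

/-- Contraction of the elements outside the range of `f`, defined as the dual of deletion;
the remaining elements are named by `f`. -/
def contractTo {F : Type u} [Field F] {E : Type v} {E₀ : Type w} [Fintype E] [Fintype E₀]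
    (M : RepMatroid F E) (f : E₀ ↪ E) : RepMatroid F E₀ :=
  (M.dual.deleteTo f).dual

/-- `M₂` is an elementary projection of `M₁` (and `M₁` is an elementary lift of `M₂`): some `M`
on the ground set `E ∪ {e}`, with `e` a new element, has `M \ e = M₁` and `M / e = M₂`.
The set `E ∪ {e}` is `Option E`, with `e = none`. -/
def IsElementaryProjection {F : Type u} [Field F] {E : Type v} [Fintype E]
    (M₂ M₁ : RepMatroid F E) : Prop :=
  ∃ M : RepMatroid F (Option E),
    M.deleteTo Function.Embedding.some = M₁ ∧ M.contractTo Function.Embedding.some = M₂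

/-- The graph on all `F`-represented matroids with ground set `E` in which two distinct matroids
are adjacent if one of them is an elementary projection of the other. -/
def liftProjectionGraph (F : Type u) [Field F] (E : Type v) [Fintype E] :
    SimpleGraph (RepMatroid F E) :=
  SimpleGraph.fromRel IsElementaryProjection

/-- The least number of elementary lifts and projections that transform `M` into `N`. -/
noncomputable def dist {F : Type u} [Field F] {E : Type v} [Fintype E]
    (M N : RepMatroid F E) : ℕ∞ :=
  (liftProjectionGraph F E).edist M N

/-- The matroid `M(A)` generated by the matrix `A`: its space is the row space of `A`. -/
def ofMatrix {F : Type u} [Field F] {E : Type v} {V : Type w} (A : Matrix V E F) :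
    RepMatroid F E where
  space := Submodule.span F (Set.range A.row)

end RepMatroid

/-- A frame matrix: every column has at most two nonzero entries. -/
def IsFrameMatrix {F : Type u} [Field F] {E : Type v} {V : Type w} (A : Matrix V E F) : Prop :=
  ∀ e : E, {x : V | A x e ≠ 0}.encard ≤ 2

/-- A `Γ`-labelled digraph with vertex set `V` and arc set `E`, loops and multiple arcs allowed. -/
structure LabelledDigraph (Γ : Type u) (V : Type w) (E : Type v) where
  /-- The tail of an arc. -/
  src : E → V
  /-- The head of an arc. -/
  tgt : E → V
  /-- The label of an arc. -/
  label : E → Γ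

/-- Every two vertices are joined by a path of the underlying undirected graph. -/
def LabelledDigraph.IsConnected {Γ : Type u} {V : Type w} {E : Type v}
    (G : LabelledDigraph Γ V E) : Prop :=
  (SimpleGraph.fromRel (fun x y : V => ∃ e, G.src e = x ∧ G.tgt e = y)).Preconnected

/-- `G` is a graph representation of the frame matrix `A`. -/
structure IsGraphRepresentation {F : Type u} [Field F] {E : Type v} {V : Type w}
    (A : Matrix V E F) (G : LabelledDigraph Fˣ V E) : Prop where
  two_entries : ∀ (e : E) (x y : V), x ≠ y → {z : V | A z e ≠ 0} = {x, y} →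
    (G.src e = x ∧ G.tgt e = y ∧ (G.label e : F) = -A x e * (A y e)⁻¹) ∨
    (G.src e = y ∧ G.tgt e = x ∧ (G.label e : F) = -A y e * (A x e)⁻¹)
  one_entry : ∀ (e : E) (x : V), {z : V | A z e ≠ 0} = {x} →
    G.src e = x ∧ G.tgt e = x ∧ G.label e ≠ 1
  no_entry : ∀ e : E, {z : V | A z e ≠ 0} = ∅ → G.src e = G.tgt e ∧ G.label e = 1

/-- `N` is a frame matroid with connected graph: it is generated by a frame matrix (with finitely
many rows) that has a connected graph representation. -/
def RepMatroid.IsConnectedFrame {F : Type u} [Field F] {E : Type v}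
    (N : RepMatroid F E) : Prop :=
  ∃ (V : Type) (_ : Finite V) (A : Matrix V E F) (G : LabelledDigraph Fˣ V E),
    IsFrameMatrix A ∧ N = RepMatroid.ofMatrix A ∧ IsGraphRepresentation A G ∧ G.IsConnected

/-! Regard each column of a frame matrix for N as an edge joining the rows that support it. An edge
set H meeting m vertices has rank at most m in N. Distance at most k puts the space of M inside that
of N plus a subspace of dimension at most k, so H has rank at most m + k in M. Thus any H with at
least m + k + 1 edges is dependent in M, and it suffices to find one of size O(log r).

Connectedness bounds the number of vertices by r(N) + 1 ≤ r + k + 1, so for large r the multigraph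
still has density above 1 + β/2. In a dense multigraph, a minimal dense vertex set expands. Balls in
it grow geometrically unless some ball of logarithmic radius meets more edges than the next ball has
vertices, and then two edges off a breadth-first tree give a small H with excess one
(`exists_small_excess`). Extracting k + 1 such subgraphs, pairwise edge-disjoint, adds up the excess
(`exists_small_large_excess`). For bounded r, any r + 1 elements are dependent. -/

/-! ### Small subgraphs with more edges than vertices -/

/-- In a multigraph on the vertex set `B` with a rooted spanning tree (parent edges `p`, parent
vertices `q`) of height at most `R` and more edges than vertices, two edges outside the tree
together with the tree paths from their ends to the root form a small subgraph with more edges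
than vertices. -/
theorem exists_small_excess_of_tree {V : Type w} {E : Type v} [DecidableEq V] [DecidableEq E]
    (s : E → Finset V) (hs : ∀ e, (s e).card ≤ 2) (B : Finset V) (D : Finset E) (root : V)
    (hroot : root ∈ B) (hDB : ∀ e ∈ D, s e ⊆ B) (lv : V → ℕ) (p : V → E) (q : V → V) (R : ℕ)
    (hR : ∀ v ∈ B, lv v ≤ R)
    (hp : ∀ v ∈ B, v ≠ root → p v ∈ D ∧ s (p v) = {v, q v} ∧ q v ∈ B ∧ lv (q v) < lv v)
    (hcard : B.card < D.card) :
    ∃ H ⊆ D, (H.biUnion s).card + 1 ≤ H.card ∧ H.card ≤ 4 * R + 6 := by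
  -- Levels drop strictly along `q`, so the path from a vertex at level n to the root has at most n
  -- + 1 vertices.
  have anc : ∀ n : ℕ, ∀ v ∈ B, lv v = n → ∃ A ⊆ B, v ∈ A ∧
      (∀ u ∈ A, u ≠ root → q u ∈ A) ∧ A.card ≤ n + 1 := by
    intro n
    induction n using Nat.strong_induction_on with
    | _ n ih =>
      intro v hv hn
      by_cases hvr : v = root
      · exact ⟨{v}, by simpa using hv, by simp, by simp [hvr], by simp⟩
      · obtain ⟨-, -, hqB, hlt⟩ := hp v hv hvr
        obtain ⟨A, hAB, hqA, hcl, hAc⟩ := ih (lv (q v)) (hn ▸ hlt) (q v) hqB rfl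
        refine ⟨insert v A, Finset.insert_subset hv hAB, Finset.mem_insert_self _ _, ?_, ?_⟩
        · intro u hu hur
          rcases Finset.mem_insert.1 hu with rfl | hu
          · exact Finset.mem_insert_of_mem hqA
          · exact Finset.mem_insert_of_mem (hcl u hu hur)
        · have := Finset.card_insert_le v A
          omega
  have anc' : ∀ v, ∃ A : Finset V, v ∈ B → A ⊆ B ∧ v ∈ A ∧
      (∀ u ∈ A, u ≠ root → q u ∈ A) ∧ A.card ≤ R + 1 := by
    intro v
    by_cases hv : v ∈ B
    · obtain ⟨A, h1, h2, h3, h4⟩ := anc _ v hv rfl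
      exact ⟨A, fun _ => ⟨h1, h2, h3, h4.trans (by have := hR v hv; omega)⟩⟩
    · exact ⟨∅, fun h => absurd h hv⟩
  choose A hA using anc'
  -- If two vertices shared a parent edge, each would be the parent of the other, and both levels
  -- would decrease.
  have hinj : Set.InjOn p (B.erase root : Finset V) := by
    intro v hv v' hv' hvv
    simp only [Finset.coe_erase, Set.mem_sdiff, Finset.mem_coe, Set.mem_singleton_iff] at hv hv'
    obtain ⟨-, h1, -, h2⟩ := hp v hv.1 hv.2
    obtain ⟨-, h1', -, h2'⟩ := hp v' hv'.1 hv'.2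
    by_contra hne
    rw [hvv, h1'] at h1
    have ha : v' ∈ ({v, q v} : Finset V) := h1 ▸ by simp
    have hb : v ∈ ({v', q v'} : Finset V) := h1 ▸ by simp
    simp only [Finset.mem_insert, Finset.mem_singleton] at ha hb
    rcases ha with ha | ha
    · exact hne ha.symm
    rcases hb with hb | hb
    · exact hne hb
    rw [← ha] at h2
    rw [← hb] at h2'
    omega
  have htwo : 1 < (D \ (B.erase root).image p).card := by
    have h1 := Finset.le_card_sdiff ((B.erase root).image p) D
    have h2 : ((B.erase root).image p).card ≤ (B.erase root).card := Finset.card_image_le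
    have h3 := Finset.card_erase_add_one hroot
    omega
  obtain ⟨e₁, he₁, e₂, he₂, hne⟩ := Finset.one_lt_card.1 htwo
  rw [Finset.mem_sdiff] at he₁ he₂
  set Z := s e₁ ∪ s e₂ with hZ
  have hZB : Z ⊆ B := Finset.union_subset (hDB _ he₁.1) (hDB _ he₂.1)
  have hZc : Z.card ≤ 4 := by
    exact (Finset.card_union_le (s e₁) (s e₂)).trans (Nat.add_le_add (hs e₁) (hs e₂))
  -- The root is inserted separately so that the tree on W has exactly |W| - 1 edges even when the
  -- two extra edges have no ends; with those two edges the excess is one.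
  set W := insert root (Z.biUnion A) with hW
  have hWB : W ⊆ B := Finset.insert_subset hroot
    (Finset.biUnion_subset.2 fun v hv => (hA v (hZB hv)).1)
  have hWc : W.card ≤ 4 * R + 5 := by
    have h1 := Finset.card_insert_le root (Z.biUnion A)
    have h2 := Finset.card_biUnion_le_card_mul Z A (R + 1) fun v hv => (hA v (hZB hv)).2.2.2
    have h3 : Z.card * (R + 1) ≤ 4 * (R + 1) := Nat.mul_le_mul_right _ hZc
    rw [← hW] at h1
    omega
  have hWcl : ∀ u ∈ W, u ≠ root → q u ∈ W := by
    intro u hu hur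
    rcases Finset.mem_insert.1 hu with rfl | hu
    · exact absurd rfl hur
    · obtain ⟨v, hv, huv⟩ := Finset.mem_biUnion.1 hu
      exact Finset.mem_insert_of_mem
        (Finset.mem_biUnion.2 ⟨v, hv, (hA v (hZB hv)).2.2.1 u huv hur⟩)
  have hZW : Z ⊆ W := fun v hv => Finset.mem_insert_of_mem
    (Finset.mem_biUnion.2 ⟨v, hv, (hA v (hZB hv)).2.1⟩)
  have herase : W.erase root ⊆ B.erase root := Finset.erase_subset_erase _ hWB
  have himg : ((W.erase root).image p).card + 1 = W.card := by
    rw [Finset.card_image_of_injOn (hinj.mono (Finset.coe_subset.2 herase))]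
    exact Finset.card_erase_add_one (Finset.mem_insert_self _ _)
  have hsub := Finset.image_subset_image (f := p) herase
  have hHc : (insert e₁ (insert e₂ ((W.erase root).image p))).card = W.card + 1 := by
    rw [Finset.card_insert_of_notMem, Finset.card_insert_of_notMem]
    · omega
    · exact fun h => he₂.2 (hsub h)
    · intro h
      rcases Finset.mem_insert.1 h with h | h
      · exact hne h
      · exact he₁.2 (hsub h)
  refine ⟨insert e₁ (insert e₂ ((W.erase root).image p)), ?_, ?_, by omega⟩
  · refine Finset.insert_subset he₁.1 (Finset.insert_subset he₂.1 ?_)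
    intro e he
    obtain ⟨v, hv, rfl⟩ := Finset.mem_image.1 he
    exact (hp v (hWB (Finset.mem_of_mem_erase hv)) (Finset.ne_of_mem_erase hv)).1
  · rw [hHc]
    refine Nat.succ_le_succ (Finset.card_le_card (Finset.biUnion_subset.2 ?_))
    intro e he
    simp only [Finset.mem_insert, Finset.mem_image] at he
    rcases he with rfl | rfl | ⟨v, hv, rfl⟩
    · exact Finset.subset_union_left.trans hZW
    · exact Finset.subset_union_right.trans hZW
    · have hvW := Finset.mem_of_mem_erase hv
      have hvr := Finset.ne_of_mem_erase hv
      rw [(hp v (hWB hvW) hvr).2.1]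
      exact Finset.insert_subset hvW (Finset.singleton_subset_iff.2 (hWcl v hvW hvr))

/-- The edges of `Y` that meet the vertex set `S`. -/
def touching {V : Type w} {E : Type v} [DecidableEq V] (s : E → Finset V) (Y : Finset E)
    (S : Finset V) : Finset E :=
  Y.filter fun e => ¬ Disjoint (s e) S

/-- The ball of radius `i` around `root` in the multigraph with edge set `Y`. -/
def graphBall {V : Type w} {E : Type v} [DecidableEq V] (s : E → Finset V) (Y : Finset E)
    (root : V) : ℕ → Finset V
  | 0 => {root}
  | i + 1 => graphBall s Y root i ∪ (touching s Y (graphBall s Y root i)).biUnion s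

theorem graphBall_mono {V : Type w} {E : Type v} [DecidableEq V] (s : E → Finset V)
    (Y : Finset E) (root : V) : Monotone (graphBall s Y root) :=
  monotone_nat_of_le_succ fun _ => Finset.subset_union_left

theorem graphBall_subset {V : Type w} {E : Type v} [DecidableEq V] (s : E → Finset V)
    (Y : Finset E) (root : V) (W : Finset V) (hroot : root ∈ W) (hY : ∀ e ∈ Y, s e ⊆ W) (i : ℕ) :
    graphBall s Y root i ⊆ W := by
  induction i with
  | zero => simpa [graphBall] using hroot
  | succ i ih =>
    exact Finset.union_subset ih
      (Finset.biUnion_subset.2 fun e he => hY e (Finset.mem_filter.1 he).1)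

/-- Breadth-first search supplies the tree: the level of a vertex is the first ball containing it,
and its parent edge is one that brought it into that ball. -/
theorem exists_small_excess_of_graphBall {V : Type w} {E : Type v} [DecidableEq V]
    [DecidableEq E] (s : E → Finset V) (hs : ∀ e, (s e).card ≤ 2) (Y : Finset E) (root : V)
    (i : ℕ)
    (hcard : (graphBall s Y root (i + 1)).card < (touching s Y (graphBall s Y root i)).card) :
    ∃ H ⊆ Y, (H.biUnion s).card + 1 ≤ H.card ∧ H.card ≤ 4 * (i + 1) + 6 := by
  classical
  let lv : V → ℕ := fun v => sInf {j | v ∈ graphBall s Y root j}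
  have hlv : ∀ v j, v ∈ graphBall s Y root j → lv v ≤ j := fun v j h => Nat.sInf_le h
  have hpar : ∀ v, ∃ eu : E × V, v ∈ graphBall s Y root (i + 1) → v ≠ root →
      eu.1 ∈ touching s Y (graphBall s Y root i) ∧ s eu.1 = {v, eu.2} ∧
      eu.2 ∈ graphBall s Y root (i + 1) ∧ lv eu.2 < lv v := by
    intro v
    by_cases hv : v ∈ graphBall s Y root (i + 1) ∧ v ≠ root
    · have hmem : v ∈ graphBall s Y root (lv v) :=
        Nat.sInf_mem (s := {j | v ∈ graphBall s Y root j}) ⟨_, hv.1⟩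
      have hle := hlv v _ hv.1
      rcases hj : lv v with _ | j
      · rw [hj] at hmem
        exact absurd (by simpa [graphBall] using hmem) hv.2
      · rw [hj] at hmem
        have hnot : v ∉ graphBall s Y root j := fun h => by
          have := hlv v j h
          omega
        rcases Finset.mem_union.1 hmem with h | h
        · exact absurd h hnot
        obtain ⟨e, he, hve⟩ := Finset.mem_biUnion.1 h
        obtain ⟨heY, hd⟩ := Finset.mem_filter.1 he
        obtain ⟨u, hu, huj⟩ := Finset.not_disjoint_iff.1 hd
        have huv : v ≠ u := fun h => hnot (h ▸ huj)
        have hse : s e = {v, u} := by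
          symm
          refine Finset.eq_of_subset_of_card_le ?_ ?_
          · exact Finset.insert_subset hve (Finset.singleton_subset_iff.2 hu)
          · rw [Finset.card_pair huv]
            exact hs e
        have hui : u ∈ graphBall s Y root i := graphBall_mono s Y root (by omega) huj
        refine ⟨(e, u), fun _ _ => ⟨?_, hse, graphBall_mono s Y root (Nat.le_succ i) hui, ?_⟩⟩
        · exact Finset.mem_filter.2 ⟨heY, Finset.not_disjoint_iff.2 ⟨u, hu, hui⟩⟩
        · have := hlv u j huj
          show lv u < _
          omega
    · have : Nonempty E := by
        have hpos : 0 < (touching s Y (graphBall s Y root i)).card := by omega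
        exact ⟨(Finset.card_pos.1 hpos).choose⟩
      exact ⟨(Classical.arbitrary E, v), fun h1 h2 => absurd ⟨h1, h2⟩ hv⟩
  choose eu heu using hpar
  obtain ⟨H, hH, h⟩ := exists_small_excess_of_tree s hs (graphBall s Y root (i + 1))
    (touching s Y (graphBall s Y root i)) root
    (graphBall_mono s Y root (Nat.zero_le _) (by simp [graphBall]))
    (fun e he => (Finset.subset_biUnion_of_mem s he).trans Finset.subset_union_right)
    lv (fun v => (eu v).1) (fun v => (eu v).2) (i + 1) (fun v hv => hlv v _ hv) heu hcard
  exact ⟨H, hH.trans (Finset.filter_subset _ _), h⟩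

/-- A multigraph with `n` vertices and at least `(1 + γ) n` edges has a subgraph of logarithmic
size with more edges than vertices. -/
theorem exists_small_excess {V : Type w} {E : Type v} [Fintype V] [DecidableEq V] [DecidableEq E]
    (s : E → Finset V) (hs : ∀ e, (s e).card ≤ 2) (γ : ℝ) (hγ : 0 < γ) (R : ℕ)
    (hR : (Fintype.card V : ℝ) < (1 + γ) ^ R) (X : Finset E) (hX : X.Nonempty)
    (hcard : (1 + γ) * (Fintype.card V : ℝ) ≤ X.card) :
    ∃ H ⊆ X, (H.biUnion s).card + 1 ≤ H.card ∧ H.card ≤ 4 * R + 6 := by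
  -- An edge without ends has excess one by itself. Excluding such edges ensures that no edge lies
  -- inside the empty vertex set.
  by_cases hempty : ∃ e ∈ X, s e = ∅
  · obtain ⟨e, he, hse⟩ := hempty
    refine ⟨{e}, by simpa using he, ?_, ?_⟩ <;> simp [hse]
  push Not at hempty
  by_contra! hno
  let inside : Finset V → Finset E := fun W => X.filter fun e => s e ⊆ W
  let good : Finset V → Prop := fun W => W.Nonempty ∧ (1 + γ) * (W.card : ℝ) ≤ (inside W).card
  have hgood : good Finset.univ := by
    constructor
    · obtain ⟨e, he⟩ := hX
      obtain ⟨v, -⟩ := hempty e he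
      exact ⟨v, Finset.mem_univ v⟩
    · simpa [inside] using hcard
  obtain ⟨W, -, hW⟩ := exists_minimal_le_of_wellFoundedLT good Finset.univ hgood
  obtain ⟨⟨root, hroot⟩, hWc⟩ := hW.prop
  have hYW : ∀ e ∈ inside W, s e ⊆ W := fun e he => (Finset.mem_filter.1 he).2
  -- By minimality the complement of a nonempty proper S is not dense, so the edges lost on removing
  -- S number at least (1 + γ)|S|.
  have hexp : ∀ S ⊆ W, (1 + γ) * (S.card : ℝ) ≤ (touching s (inside W) S).card := by
    intro S hS
    have hsplit : (touching s (inside W) S).card + (inside (W \ S)).card = (inside W).card := by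
      rw [← Finset.card_filter_add_card_filter_not (s := inside W) (fun e => ¬ Disjoint (s e) S)]
      congr 2
      ext e
      simp only [inside, Finset.mem_filter, Finset.subset_sdiff, not_not]
      tauto
    have hsplit' : ((touching s (inside W) S).card : ℝ) + (inside (W \ S)).card
        = (inside W).card := by exact_mod_cast hsplit
    have hdiff : ((W \ S).card : ℝ) + S.card = W.card := by
      exact_mod_cast Finset.card_sdiff_add_card_eq_card hS
    rcases S.eq_empty_or_nonempty with rfl | hSne
    · simp
    by_cases hSW : (W \ S).Nonempty
    · have hlt : ((inside (W \ S)).card : ℝ) < (1 + γ) * ((W \ S).card : ℝ) := by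
        by_contra! hge
        have hle := hW.le_of_le ⟨hSW, hge⟩ Finset.sdiff_subset
        obtain ⟨v, hv⟩ := hSne
        exact (Finset.mem_sdiff.1 (hle (hS hv))).2 hv
      nlinarith
    · rw [Finset.not_nonempty_iff_eq_empty] at hSW
      have h0 : (inside (W \ S)).card = 0 := by
        rw [hSW, Finset.card_eq_zero, Finset.filter_eq_empty_iff]
        exact fun e he h => (hempty e he).ne_empty (Finset.subset_empty.1 h)
      rw [hSW] at hdiff
      rw [h0] at hsplit'
      simp only [Finset.card_empty, Nat.cast_zero, zero_add, add_zero] at hdiff hsplit'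
      rw [hsplit', hdiff]
      exact hWc
  -- Without a small excess, each ball has at least as many vertices as there are edges meeting the
  -- previous ball; expansion then gives a factor 1 + γ per step, which at radius R exceeds |V|.
  have hgrow : ∀ i ≤ R, (1 + γ) ^ i ≤ ((graphBall s (inside W) root i).card : ℝ) := by
    intro i
    induction i with
    | zero => simp [graphBall]
    | succ i ih =>
      intro hi
      have hle : (touching s (inside W) (graphBall s (inside W) root i)).card ≤
          (graphBall s (inside W) root (i + 1)).card := by
        by_contra! hlt
        obtain ⟨H, hHY, h1, h2⟩ := exists_small_excess_of_graphBall s hs _ root i hlt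
        have := hno H (hHY.trans (Finset.filter_subset _ _)) h1
        omega
      have hle' : ((touching s (inside W) (graphBall s (inside W) root i)).card : ℝ) ≤
          (graphBall s (inside W) root (i + 1)).card := by exact_mod_cast hle
      have h3 := hexp _ (graphBall_subset s _ root W hroot hYW i)
      calc (1 + γ) ^ (i + 1) = (1 + γ) * (1 + γ) ^ i := by ring
        _ ≤ (1 + γ) * ((graphBall s (inside W) root i).card : ℝ) := by
          have := ih (by omega)
          gcongr
        _ ≤ _ := h3.trans hle'
  have h1 := hgrow R le_rfl
  have h2 : ((graphBall s (inside W) root R).card : ℝ) ≤ Fintype.card V := by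
    exact_mod_cast Finset.card_le_univ _
  linarith

/-- A sufficiently dense multigraph has a subgraph of logarithmic size whose number of edges
exceeds its number of vertices by at least `j + 1`. -/
theorem exists_small_large_excess {V : Type w} {E : Type v} [Fintype V] [DecidableEq V]
    [DecidableEq E] (s : E → Finset V) (hs : ∀ e, (s e).card ≤ 2) (γ : ℝ) (hγ : 0 < γ) (R : ℕ)
    (hR : (Fintype.card V : ℝ) < (1 + γ) ^ R) (j : ℕ) (X : Finset E)
    (hcard : (1 + γ) * (Fintype.card V : ℝ) + j * (4 * R + 6) < X.card) :
    ∃ H ⊆ X, (H.biUnion s).card + (j + 1) ≤ H.card ∧ H.card ≤ (j + 1) * (4 * R + 6) := by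
  induction j with
  | zero =>
    simp only [Nat.cast_zero, zero_mul, add_zero] at hcard
    have hpos : (0 : ℝ) < X.card := lt_of_le_of_lt (by positivity) hcard
    simpa using exists_small_excess s hs γ hγ R hR X
      (Finset.card_pos.1 (by exact_mod_cast hpos)) hcard.le
  | succ j ih =>
    push_cast at hcard
    have hmul : ((j : ℝ) + 1) * (4 * R + 6) = j * (4 * R + 6) + (4 * R + 6) := by ring
    have hR0 : (0 : ℝ) ≤ 4 * R + 6 := by positivity
    obtain ⟨H, hHX, hH1, hH2⟩ := ih (by linarith)
    have hH2' : (H.card : ℝ) ≤ (j + 1) * (4 * R + 6) := by exact_mod_cast hH2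
    have hsd : ((X \ H).card : ℝ) + H.card = X.card := by
      exact_mod_cast Finset.card_sdiff_add_card_eq_card hHX
    have hpos : (0 : ℝ) ≤ (1 + γ) * (Fintype.card V : ℝ) := by positivity
    -- The term `j * (4 * R + 6)` in the hypothesis pays for the edges of H removed so far. Edge
    -- counts of H and H' add, while vertex counts are subadditive.
    obtain ⟨H', hH'X, hH'1, hH'2⟩ := exists_small_excess s hs γ hγ R hR (X \ H)
      (Finset.card_pos.1 (by
        have : (0 : ℝ) < (X \ H).card := by linarith
        exact_mod_cast this)) (by linarith)
    have hdisj : Disjoint H H' :=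
      Finset.disjoint_of_subset_right hH'X Finset.disjoint_sdiff
    refine ⟨H ∪ H', Finset.union_subset hHX (hH'X.trans Finset.sdiff_subset), ?_, ?_⟩
    · have h1 := Finset.card_union_le (H.biUnion s) (H'.biUnion s)
      rw [Finset.card_union_of_disjoint hdisj, Finset.union_biUnion]
      omega
    · rw [Finset.card_union_of_disjoint hdisj]
      nlinarith

/-! ### Lifts, projections and rank -/

namespace RepMatroid

/-- The double orthogonal complement of a subspace is the subspace itself. -/
theorem dual_dual {F : Type u} [Field F] {E : Type v} [Fintype E] (M : RepMatroid F E) :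
    M.dual.dual = M := by
  classical
  ext x
  refine ⟨fun hx => ?_, fun hx y hy => by rw [dotProduct_comm]; exact hy x hx⟩
  by_contra hxM
  obtain ⟨f, hfx, hf⟩ := Submodule.exists_le_ker_of_notMem hxM
  obtain ⟨z, rfl⟩ := (dotProductEquiv F E).surjective f
  simp only [dotProductEquiv_apply_apply] at hfx
  apply hfx
  rw [dotProduct_comm]
  exact hx z fun y hy => LinearMap.mem_ker.1 (hf hy)

/-- By double duality, the space of P / e consists of the vectors whose extension by zero at e lies
in P. Subtracting a multiple of one vector of P that is nonzero at e clears that coordinate, so the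
two spaces differ by at most one dimension. -/
theorem space_le_of_isElementaryProjection {F : Type u} [Field F] {E : Type v}
    [Fintype E] {M₂ M₁ : RepMatroid F E} (h : IsElementaryProjection M₂ M₁) :
    M₂.space ≤ M₁.space ∧ ∃ y : E → F, M₁.space ≤ M₂.space ⊔ Submodule.span F {y} := by
  obtain ⟨P, rfl, rfl⟩ := h
  have hdot : ∀ (z : Option E → F) (x : E → F),
      z ⬝ᵥ (fun o => o.elim 0 x) = (LinearMap.funLeft F F Function.Embedding.some z) ⬝ᵥ x := by
    intro z x
    simp [dotProduct, Fintype.sum_option, LinearMap.funLeft_apply]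
  have hmem : ∀ x : E → F, x ∈ (P.contractTo Function.Embedding.some).space ↔
      (fun o : Option E => o.elim 0 x) ∈ P.space := by
    intro x
    conv_rhs => rw [← P.dual_dual]
    constructor
    · intro hx z hz
      rw [dotProduct_comm, hdot, dotProduct_comm]
      exact hx _ ⟨z, hz, rfl⟩
    · rintro hx _ ⟨z, hz, rfl⟩
      rw [dotProduct_comm, ← hdot, dotProduct_comm]
      exact hx z hz
  constructor
  · intro x hx
    exact ⟨_, (hmem x).1 hx, by ext e; simp [LinearMap.funLeft_apply]⟩
  · by_cases hp : ∃ p ∈ P.space, p none ≠ 0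
    · obtain ⟨p, hp, hp0⟩ := hp
      refine ⟨LinearMap.funLeft F F Function.Embedding.some p, ?_⟩
      rintro _ ⟨z, hz, rfl⟩
      refine Submodule.mem_sup.2 ⟨LinearMap.funLeft F F Function.Embedding.some
        (z - (z none / p none) • p), ?_, (z none / p none) •
        LinearMap.funLeft F F Function.Embedding.some p,
        Submodule.smul_mem _ _ (Submodule.mem_span_singleton_self _), by simp⟩
      rw [hmem]
      convert P.space.sub_mem hz (P.space.smul_mem (z none / p none) hp) using 1
      ext (_ | e)
      · simp [hp0]
      · simp [LinearMap.funLeft_apply]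
    · push Not at hp
      refine ⟨0, le_sup_of_le_left ?_⟩
      rintro _ ⟨z, hz, rfl⟩
      rw [hmem]
      convert (SetLike.mem_coe.1 hz) using 1
      ext (_ | e)
      · simp [hp z hz]
      · simp [LinearMap.funLeft_apply]

/-- Each step enlarges the space by at most one vector; K collects these vectors. -/
theorem space_le_sup_of_walk {F : Type u} [Field F] {E : Type v} [Fintype E]
    {M N : RepMatroid F E} (p : (liftProjectionGraph F E).Walk M N) :
    ∃ K : Submodule F (E → F), Module.finrank F K ≤ p.length ∧ M.space ≤ N.space ⊔ K := by
  induction p with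
  | nil => exact ⟨⊥, by simp, by simp⟩
  | @cons M₁ M₂ N hadj p ih =>
    obtain ⟨K, hK, hle⟩ := ih
    have hstep : ∃ y : E → F, M₁.space ≤ M₂.space ⊔ Submodule.span F {y} := by
      rcases ((SimpleGraph.fromRel_adj _ _ _).1 hadj).2 with h | h
      · exact ⟨0, le_sup_of_le_left (space_le_of_isElementaryProjection h).1⟩
      · exact (space_le_of_isElementaryProjection h).2
    obtain ⟨y, hy⟩ := hstep
    refine ⟨K ⊔ Submodule.span F {y}, ?_, ?_⟩
    · have h1 := Submodule.finrank_add_le_finrank_add_finrank K (Submodule.span F {y})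
      have h2 := finrank_span_le_card (R := F) ({y} : Set (E → F))
      simp only [Set.toFinset_singleton, Finset.card_singleton] at h2
      rw [SimpleGraph.Walk.length_cons]
      omega
    · rw [← sup_assoc]
      exact hy.trans (sup_le_sup_right hle _)

theorem space_le_sup_of_dist_le {F : Type u} [Field F] {E : Type v} [Fintype E]
    {M N : RepMatroid F E} {k : ℕ} (h : dist M N ≤ (k : ℕ∞)) :
    ∃ K : Submodule F (E → F), Module.finrank F K ≤ k ∧ M.space ≤ N.space ⊔ K := by
  have htop : (liftProjectionGraph F E).edist M N ≠ ⊤ :=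
    ne_top_of_le_ne_top (ENat.natCast_ne_top k) h
  obtain ⟨p, hp⟩ := SimpleGraph.exists_walk_of_edist_ne_top htop
  obtain ⟨K, hK, hle⟩ := space_le_sup_of_walk p
  refine ⟨K, hK.trans ?_, hle⟩
  have h' : (p.length : ℕ∞) ≤ k := hp ▸ h
  exact_mod_cast h'

theorem dist_comm {F : Type u} [Field F] {E : Type v} [Fintype E] (M N : RepMatroid F E) :
    dist M N = dist N M :=
  SimpleGraph.edist_comm

theorem rank_eq_finrank_space {F : Type u} [Field F] {E : Type v} [Fintype E]
    (M : RepMatroid F E) : M.rank = Module.finrank F M.space := by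
  have hinj : Function.Injective
      (LinearMap.funLeft F F fun x : (Finset.univ : Finset E) => (x : E)) :=
    LinearMap.funLeft_injective_of_surjective F F _ fun x => ⟨⟨x, Finset.mem_univ x⟩, rfl⟩
  exact (Submodule.equivMapOfInjective _ hinj M.space).finrank_eq.symm

theorem rk_le_rank {F : Type u} [Field F] {E : Type v} [Fintype E] (M : RepMatroid F E)
    (X : Finset E) : M.rk X ≤ M.rank := by
  rw [rank_eq_finrank_space]
  exact Submodule.finrank_map_le _ _

/-- The rank of `X` in the matroid of a matrix is at most the number of rows that are nonzero
somewhere on `X`. -/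
theorem rk_ofMatrix_le {F : Type u} [Field F] {E : Type v} {V : Type w} (A : Matrix V E F)
    (X : Finset E) (S : Finset V) (hS : ∀ e ∈ X, ∀ v, A v e ≠ 0 → v ∈ S) :
    (ofMatrix A).rk X ≤ S.card := by
  classical
  let g : V → X → F := fun v => LinearMap.funLeft F F (fun x : X => (x : E)) (A.row v)
  have hle : (ofMatrix A).restrictSpace X ≤ Submodule.span F (S.image g : Finset (X → F)) := by
    rw [restrictSpace, ofMatrix, Submodule.map_span, Submodule.span_le]
    rintro _ ⟨_, ⟨v, rfl⟩, rfl⟩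
    by_cases hv : v ∈ S
    · exact Submodule.subset_span (Finset.mem_coe.2 (Finset.mem_image_of_mem g hv))
    · have h0 : LinearMap.funLeft F F (fun x : X => (x : E)) (A.row v) = 0 := by
        ext x
        by_contra hne
        exact hv (hS x x.2 v hne)
      rw [h0]
      exact Submodule.zero_mem _
  exact (Submodule.finrank_mono hle).trans
    ((finrank_span_finset_le_card _).trans Finset.card_image_le)

theorem rk_le_rk_add {F : Type u} [Field F] {E : Type v} [Fintype E] {M N : RepMatroid F E}
    {K : Submodule F (E → F)} (h : M.space ≤ N.space ⊔ K) (X : Finset E) :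
    M.rk X ≤ N.rk X + Module.finrank F K := by
  let f : (E → F) →ₗ[F] (X → F) := LinearMap.funLeft F F fun x : X => (x : E)
  have h1 : M.space.map f ≤ N.space.map f ⊔ K.map f :=
    (Submodule.map_mono h).trans (Submodule.map_sup _ _ _).le
  calc M.rk X ≤ Module.finrank F ↥(N.space.map f ⊔ K.map f) := Submodule.finrank_mono h1
    _ ≤ Module.finrank F (N.space.map f) + Module.finrank F (K.map f) :=
      Submodule.finrank_add_le_finrank_add_finrank _ _
    _ ≤ N.rk X + Module.finrank F K := Nat.add_le_add_left (Submodule.finrank_map_le _ _) _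

/-- A dependent set bounds the girth. -/
theorem exists_girth_eq_of_dependent {F : Type u} [Field F] {E : Type v} {M : RepMatroid F E}
    {X : Finset E} (hX : M.Dependent X) : ∃ g : ℕ, M.girth = (g : ℕ∞) ∧ g ≤ X.card := by
  obtain ⟨C, hCX, hC⟩ := exists_minimal_le_of_wellFoundedLT M.Dependent X hX
  have hle : M.girth ≤ (X.card : ℕ∞) :=
    (iInf₂_le C hC).trans (by exact_mod_cast Finset.card_le_card hCX)
  lift M.girth to ℕ using ne_top_of_le_ne_top (ENat.natCast_ne_top _) hle with g hg
  exact ⟨g, rfl, by exact_mod_cast hle⟩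

theorem dependent_of_rk_lt {F : Type u} [Field F] {E : Type v} {M : RepMatroid F E}
    {X : Finset E} (h : M.rk X < X.card) : M.Dependent X :=
  h.ne

end RepMatroid

/-! ### Frame matrices with connected graph -/

theorem IsGraphRepresentation.apply_eq_zero_of_src_ne_tgt {F : Type u} [Field F] {E : Type v}
    {V : Type w} {A : Matrix V E F} {G : LabelledDigraph Fˣ V E} (hA : IsFrameMatrix A)
    (hG : IsGraphRepresentation A G) (e : E) (hne : G.src e ≠ G.tgt e) :
    {z : V | A z e ≠ 0} = {G.src e, G.tgt e} := by
  have h2 := hA e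
  rcases Set.eq_empty_or_nonempty {z : V | A z e ≠ 0} with h0 | ⟨x, hx⟩
  · exact absurd (hG.no_entry e h0).1 hne
  by_cases h1 : {z : V | A z e ≠ 0} = {x}
  · obtain ⟨ha, hb, -⟩ := hG.one_entry e x h1
    exact absurd (ha.trans hb.symm) hne
  · obtain ⟨y, hy, hyx⟩ : ∃ y ∈ {z : V | A z e ≠ 0}, y ≠ x := by
      by_contra! hall
      exact h1 (Set.eq_singleton_iff_unique_mem.2 ⟨hx, hall⟩)
    have hpair : {z : V | A z e ≠ 0} = {x, y} := by
      symm
      refine Set.Finite.eq_of_subset_of_encard_le (Set.toFinite _) ?_ ?_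
      · exact Set.insert_subset hx (Set.singleton_subset_iff.2 hy)
      · rw [Set.encard_pair hyx.symm]
        exact h2
    rcases hG.two_entries e x y hyx.symm hpair with ⟨ha, hb, -⟩ | ⟨ha, hb, -⟩
    · rw [ha, hb, hpair]
    · rw [ha, hb, hpair, Set.pair_comm]

/-- A connected frame matrix has corank at most one in its rows. -/
theorem IsGraphRepresentation.card_le_rank_add_one {F : Type u} [Field F] {E : Type v} [Fintype E]
    {V : Type w} [Fintype V] {A : Matrix V E F} {G : LabelledDigraph Fˣ V E}
    (hA : IsFrameMatrix A) (hG : IsGraphRepresentation A G) (hconn : G.IsConnected) :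
    Fintype.card V ≤ (RepMatroid.ofMatrix A).rank + 1 := by
  classical
  have hrk : (RepMatroid.ofMatrix A).rank = Module.finrank F (LinearMap.range A.vecMulLinear) := by
    rw [RepMatroid.rank_eq_finrank_space, range_vecMulLinear]
    rfl
  -- Across a non-loop arc, a row dependency vanishes at one end exactly when it vanishes at the
  -- other. By connectedness, its value at a single vertex then determines it.
  have hker : Module.finrank F (LinearMap.ker A.vecMulLinear) ≤ 1 := by
    rcases isEmpty_or_nonempty V with hV | ⟨⟨v₀⟩⟩
    · exact (Submodule.finrank_le _).trans (by simp)
    have hstep : ∀ x ∈ LinearMap.ker A.vecMulLinear, ∀ e, G.src e ≠ G.tgt e →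
        (x (G.src e) = 0 ↔ x (G.tgt e) = 0) := by
      intro x hx e hne
      have hset := hG.apply_eq_zero_of_src_ne_tgt hA e hne
      have h0 : ∀ v, v ≠ G.src e → v ≠ G.tgt e → A v e = 0 := by
        intro v h1 h2
        by_contra h
        have hv : v ∈ {z : V | A z e ≠ 0} := h
        rw [hset] at hv
        rcases hv with hv | hv
        · exact h1 hv
        · exact h2 hv
      have hs : A (G.src e) e ≠ 0 := by
        have : G.src e ∈ {z : V | A z e ≠ 0} := hset ▸ Set.mem_insert _ _
        exact this
      have ht : A (G.tgt e) e ≠ 0 := by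
        have : G.tgt e ∈ {z : V | A z e ≠ 0} := hset ▸ Set.mem_insert_of_mem _ rfl
        exact this
      have hxe : ∑ v, x v * A v e = 0 := congrFun (LinearMap.mem_ker.1 hx) e
      rw [Fintype.sum_eq_add (G.src e) (G.tgt e) hne
        fun v hv => by rw [h0 v hv.1 hv.2, mul_zero]] at hxe
      constructor
      · intro h
        rw [h, zero_mul, zero_add] at hxe
        exact (mul_eq_zero.1 hxe).resolve_right ht
      · intro h
        rw [h, zero_mul, add_zero] at hxe
        exact (mul_eq_zero.1 hxe).resolve_right hs
    have hwalk : ∀ x ∈ LinearMap.ker A.vecMulLinear, x v₀ = 0 → x = 0 := by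
      intro x hx hx0
      ext v
      obtain ⟨p⟩ := hconn v v₀
      induction p with
      | nil => exact hx0
      | @cons a b c hadj p ih =>
        have hb := ih hx0
        obtain ⟨hab, ⟨e, rfl, rfl⟩ | ⟨e, rfl, rfl⟩⟩ := (SimpleGraph.fromRel_adj _ _ _).1 hadj
        · exact (hstep x hx e hab).2 hb
        · exact (hstep x hx e hab.symm).1 hb
    let f : LinearMap.ker A.vecMulLinear →ₗ[F] F :=
      (LinearMap.proj v₀).comp (LinearMap.ker A.vecMulLinear).subtype
    have hf : Function.Injective f := by
      rw [← LinearMap.ker_eq_bot, LinearMap.ker_eq_bot']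
      exact fun x hx => Subtype.ext (hwalk x x.2 hx)
    simpa using LinearMap.finrank_le_finrank_of_injective hf
  have := LinearMap.finrank_range_add_finrank_ker A.vecMulLinear
  rw [Module.finrank_fintype_fun_eq_card] at this
  omega

/-- A matroid close to a frame matroid with connected graph, with many more elements than its
rank, has a small dependent set. -/
theorem RepMatroid.exists_dependent_of_isConnectedFrame {F : Type u} [Field F] {E : Type v}
    [Fintype E] {M N : RepMatroid F E} {k : ℕ} (hN : N.IsConnectedFrame)
    (hdist : RepMatroid.dist M N ≤ (k : ℕ∞)) (γ : ℝ) (hγ : 0 < γ) (R : ℕ)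
    (hR : (M.rank : ℝ) + k + 1 < (1 + γ) ^ R)
    (hcard : (1 + γ) * ((M.rank : ℝ) + k + 1) + k * (4 * R + 6) < Fintype.card E) :
    ∃ X : Finset E, M.Dependent X ∧ X.card ≤ (k + 1) * (4 * R + 6) := by
  classical
  obtain ⟨V, hV, A, G, hA, rfl, hG, hconn⟩ := hN
  have : Fintype V := Fintype.ofFinite V
  obtain ⟨K, hK, hle⟩ := RepMatroid.space_le_sup_of_dist_le hdist
  -- Both directions are needed: this one bounds the rank of N, hence the number of vertices; the
  -- other bounds ranks in M.
  rw [RepMatroid.dist_comm] at hdist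
  obtain ⟨K', hK', hle'⟩ := RepMatroid.space_le_sup_of_dist_le hdist
  have hrank : (ofMatrix A).rank ≤ M.rank + k :=
    (RepMatroid.rk_le_rk_add hle' Finset.univ).trans (Nat.add_le_add_left hK' _)
  have hn : Fintype.card V ≤ M.rank + k + 1 := by
    have := hG.card_le_rank_add_one hA hconn
    omega
  have hn' : (Fintype.card V : ℝ) ≤ M.rank + k + 1 := by exact_mod_cast hn
  let s : E → Finset V := fun e => Finset.univ.filter fun v => A v e ≠ 0
  have hs : ∀ e, (s e).card ≤ 2 := by
    intro e
    have h := hA e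
    have hcoe : {x : V | A x e ≠ 0} = (s e : Set V) := by
      ext v
      simp [s]
    rw [hcoe, Set.encard_coe_eq_coe_finsetCard] at h
    exact_mod_cast h
  obtain ⟨H, -, h1, h2⟩ := exists_small_large_excess s hs γ hγ R (hn'.trans_lt hR) k Finset.univ
    (by
      rw [Finset.card_univ]
      refine lt_of_le_of_lt ?_ hcard
      gcongr)
  refine ⟨H, RepMatroid.dependent_of_rk_lt ?_, h2⟩
  have h3 := RepMatroid.rk_le_rk_add hle H
  have h4 := RepMatroid.rk_ofMatrix_le A H (H.biUnion s) fun e he v hv =>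
    Finset.mem_biUnion.2 ⟨e, he, by simpa [s] using hv⟩
  omega

/-! ### Choice of constants and the logarithmic bound -/

/-- The linear function `b r` eventually dominates `a + d log r`. -/
theorem eventually_add_mul_log_lt (a d b : ℝ) (hb : 0 < b) :
    ∀ᶠ r : ℕ in Filter.atTop, a + d * Real.log r < b * r := by
  have hlog : (fun x : ℝ => a + d * Real.log x) =o[Filter.atTop] fun x : ℝ => x :=
    (Asymptotics.isLittleO_const_id_atTop a).add (Real.isLittleO_log_id_atTop.const_mul_left d)
  have h := (hlog.bound (half_pos hb)).and (Filter.eventually_gt_atTop (0 : ℝ))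
  filter_upwards [tendsto_natCast_atTop_atTop.eventually h] with r hr
  obtain ⟨h1, h2⟩ := hr
  rw [Real.norm_eq_abs, Real.norm_eq_abs, abs_of_pos h2] at h1
  nlinarith [le_abs_self (a + d * Real.log r)]

theorem one_le_log_natCast {r : ℕ} (hr : 2 < r) : 1 ≤ Real.log (r : ℝ) := by
  have h3 : (3 : ℝ) ≤ r := by exact_mod_cast hr
  rw [Real.le_log_iff_exp_le (by linarith)]
  linarith [Real.exp_one_lt_d9]

theorem mainTheorem4 (F : Type u) [Field F] [Finite F] (k : ℕ) (hk : 0 < k)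
    (β : ℝ) (hβ : 0 < β) :
    ∃ c : ℤ, ∀ (E : Type v) [Fintype E] (M : RepMatroid F E),
      2 < M.rank →
      (1 + β) * (M.rank : ℝ) ≤ (Fintype.card E : ℝ) →
      (∃ N : RepMatroid F E, N.IsConnectedFrame ∧ RepMatroid.dist M N ≤ (k : ℕ∞)) →
      ∃ g : ℕ, M.girth = (g : ℕ∞) ∧ (g : ℝ) ≤ (c : ℝ) * Real.log (M.rank : ℝ) := by
  have hγ : 0 < β / 2 := by positivity
  have hlogγ : 0 < Real.log (1 + β / 2) := Real.log_pos (by linarith)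
  -- With R = ⌈L log r⌉ this gives (1 + β/2)^R ≥ r³, which exceeds r + k + 1 once r ≥ k + 2.
  let L : ℝ := 3 / Real.log (1 + β / 2)
  have hL : 0 < L := by positivity
  -- Chosen so that 4R + 6 ≤ B log r, using log r ≥ 1.
  let B : ℝ := 4 * (L + 1) + 6
  -- Half of the density surplus, (β/2) r, absorbs both the k + 1 possible extra vertices and the
  -- edges removed during extraction.
  obtain ⟨r₀, hr₀⟩ := Filter.eventually_atTop.1
    (eventually_add_mul_log_lt ((1 + β / 2) * (k + 1)) (k * B) (β / 2) hγ)
  let r₁ : ℕ := max r₀ (k + 2)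
  -- The first summand serves rank at least `r₁`, the second smaller rank.
  refine ⟨⌈(k + 1) * B + (r₁ + 1)⌉, fun E _ M hr hE hN => ?_⟩
  obtain ⟨N, hN, hdist⟩ := hN
  have hlog := one_le_log_natCast hr
  have hr3 : (3 : ℝ) ≤ M.rank := by exact_mod_cast hr
  have hB : 0 < B := by positivity
  suffices h : ∃ X : Finset E, M.Dependent X ∧
      (X.card : ℝ) ≤ ((k + 1) * B + (r₁ + 1)) * Real.log M.rank by
    obtain ⟨X, hX, hXc⟩ := h
    obtain ⟨g, hg, hgX⟩ := RepMatroid.exists_girth_eq_of_dependent hX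
    refine ⟨g, hg, ?_⟩
    have hgX' : (g : ℝ) ≤ X.card := by exact_mod_cast hgX
    refine (hgX'.trans hXc).trans ?_
    have := Int.le_ceil ((k + 1) * B + ((r₁ : ℝ) + 1))
    gcongr
  by_cases hbig : r₁ ≤ M.rank
  · have hk2 : (k : ℝ) + 2 ≤ M.rank := by
      exact_mod_cast (le_max_right r₀ (k + 2)).trans hbig
    have hR1 : L * Real.log M.rank ≤ ⌈L * Real.log M.rank⌉₊ := Nat.le_ceil _
    have hR2 : (⌈L * Real.log M.rank⌉₊ : ℝ) ≤ (L + 1) * Real.log M.rank := by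
      have := (Nat.ceil_lt_add_one (a := L * Real.log M.rank) (by positivity)).le
      linarith
    have hR3 : 4 * (⌈L * Real.log M.rank⌉₊ : ℝ) + 6 ≤ B * Real.log M.rank := by
      simp only [B]
      linarith
    have hpow : (M.rank : ℝ) ^ 3 ≤ (1 + β / 2) ^ ⌈L * Real.log M.rank⌉₊ := by
      rw [← Real.log_le_log_iff (by positivity) (by positivity), Real.log_pow, Real.log_pow]
      calc ((3 : ℕ) : ℝ) * Real.log M.rank
          = L * Real.log M.rank * Real.log (1 + β / 2) := by
            rw [mul_right_comm, div_mul_cancel₀ _ hlogγ.ne', Nat.cast_ofNat]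
        _ ≤ _ := by gcongr
    have hcube : (9 : ℝ) * M.rank ≤ (M.rank : ℝ) ^ 3 := by
      rw [pow_succ]
      gcongr
      nlinarith
    obtain ⟨X, hX, hXc⟩ := RepMatroid.exists_dependent_of_isConnectedFrame hN hdist (β / 2) hγ
      ⌈L * Real.log M.rank⌉₊ (lt_of_lt_of_le (by linarith) hpow) (by
        have h1 := hr₀ M.rank ((le_max_left r₀ (k + 2)).trans hbig)
        have h2 := mul_le_mul_of_nonneg_left hR3 (Nat.cast_nonneg (α := ℝ) k)
        linarith)
    refine ⟨X, hX, ?_⟩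
    have hXc' : (X.card : ℝ) ≤ (k + 1) * (4 * ⌈L * Real.log M.rank⌉₊ + 6) := by
      exact_mod_cast hXc
    have h2 := mul_le_mul_of_nonneg_left hR3 (by positivity : (0 : ℝ) ≤ k + 1)
    have h3 : 0 ≤ ((r₁ : ℝ) + 1) * Real.log M.rank := by positivity
    linarith
  · have hlt : M.rank + 1 ≤ Fintype.card E := by
      have : (M.rank : ℝ) < Fintype.card E := by nlinarith
      exact_mod_cast this
    obtain ⟨X, -, hXc⟩ := Finset.exists_subset_card_eq (s := (Finset.univ : Finset E))
      (n := M.rank + 1) (by simpa using hlt)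
    refine ⟨X, RepMatroid.dependent_of_rk_lt ?_, ?_⟩
    · have := M.rk_le_rank X
      omega
    · have h1 : (X.card : ℝ) ≤ r₁ + 1 := by
        rw [hXc]
        push_cast
        have : (M.rank : ℝ) ≤ r₁ := by exact_mod_cast (not_le.1 hbig).le
        linarith
      have h2 : 0 ≤ ((k : ℝ) + 1) * B := by positivity
      nlinarith
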